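/- Let $d,k\in\mathbb N$ and $B\ge 0$. A probability distribution $\mathcal D$ of pairs $(x,y)$, with $x$ in the Euclidean unit ball of $\mathbb R^d$ and $y\in\{\pm1\}$, is called $(k,B)$-realizable if there are a set $\kappa\subseteq\{1,\dots,d\}$ with $|\kappa|\le k$ and a vector $w\in\mathbb R^d$ with $\|w\|_2^2\le B^2$ such that, almost surely, $y=1$ whenever $x(j)>0$ for some $j\in\kappa$, and $y\langle w,x\rangle\ge 1$ whenever $x(j)\le 0$ for all $j\in\kappa$. For measurable $h:\mathbb R^d\to\mathbb R$ let $\ell_{\mathrm{ramp}}(h,\mathcal D)=\mathbb E_{(x,y)\sim\mathcal D}\max\bigl(0,\min(1-y\,h(x),1)\bigr)$. A learning algorithm $A$ maps a finite sample $S$ of examples, possibly using internal randomness, to a measurable function $A(S):\mathbb R^d\to\mathbb R$. For $\epsilon,\delta\in(0,1)$ let $m_A(\epsilon,\delta)\in\mathbb N\cup\{\infty\}$ be the least $n$ such that for every $(k,B)$-realizable $\mathcal D$ and every $m\ge n$, with probability at least $1-\delta$ over a sample $S$ of $m$ i.i.d. examples from $\mathcal D$ and the internal randomness of $A$, one has $\ell_{\mathrm{ramp}}(A(S),\mathcal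 D)\le\epsilon$. The sample complexity of learning $(k,B)$-realizable distributions is $m_{d,k,B}(\epsilon,\delta)=\min_A m_A(\epsilon,\delta)$, the minimum over all learning algorithms (which may depend on $d,k,B,\epsilon,\delta$). **Corollary.** For fixed $\delta$, the sample complexity of learning $(k,B)$-realizable distributions is $\tilde O\bigl((k\log d+B^2)/\epsilon\bigr)$. That is, there is a constant $c\in\mathbb N$, and for every $\delta\in(0,1)$ there is a constant $C>0$ depending only on $\delta$, such that for all $d,k\in\mathbb N$, $B\ge0$ and $\epsilon\in(0,1)$, with $F=(k\log d+B^2)/\epsilon$ (and $\log 0:=0$), the number $m_{d,k,B}(\epsilon,\delta)$ is finite and $$m_{d,k,B}(\epsilon,\delta)\le C\,F\,\bigl(\log(F+2)\bigr)^c .$$ -/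

import Mathlib

open MeasureTheory

noncomputable section

namespace RulesFirst

/-- The instance space `ℝ^d` with its Euclidean norm. -/
abbrev Feature (d : ℕ) : Type := EuclideanSpace ℝ (Fin d)

/-- The label space `{±1}`, as a set of real numbers. -/
abbrev Label : Type := ({1, -1} : Set ℝ)

/-- A labelled example `(x, y)`. -/
abbrev Example (d : ℕ) : Type := Feature d × Label

/-- The ramp loss `⟦1 - ŷ y⟧`, where `⟦r⟧ = max (0, min (r, 1))`. -/
def rampLoss (yhat y : ℝ) : ℝ := max 0 (min (1 - yhat * y) 1)

/-- The expected ramp loss of the predictor `h` with respect to `D`. (It is only used for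
measurable `h` and probability measures `D`, where the integrand is integrable.) -/
def rampRisk {d : ℕ} (h : Feature d → ℝ) (D : Measure (Example d)) : ℝ :=
  ∫ p, rampLoss (h p.1) (p.2 : ℝ) ∂D

/-- `D` is `(k, B)`-realizable: for some set `κ` of at most `k` features and some `w` with
`‖w‖₂² ≤ B²`, almost surely the label is `1` if some feature in `κ` is positive, and
almost surely `y ⟨w, x⟩ ≥ 1` if no feature in `κ` is positive. -/
def IsKBRealizable {d : ℕ} (k : ℕ) (B : ℝ) (D : Measure (Example d)) : Prop :=
  ∃ (κ : Finset (Fin d)) (w : Feature d), κ.card ≤ k ∧ ‖w‖ ^ 2 ≤ B ^ 2 ∧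
    (∀ᵐ p ∂D, (∃ j ∈ κ, 0 < p.1 j) → (p.2 : ℝ) = 1) ∧
    (∀ᵐ p ∂D, (∀ j ∈ κ, p.1 j ≤ 0) → 1 ≤ (p.2 : ℝ) * inner ℝ w p.1)

/-- The `(k, B)`-realizable probability distributions of examples `(x, y)` with `x` in the
Euclidean unit ball of `ℝ^d`. -/
def kbDistributions (d k : ℕ) (B : ℝ) : Set (Measure (Example d)) :=
  {D | IsProbabilityMeasure D ∧ (∀ᵐ p ∂D, ‖p.1‖ ≤ 1) ∧ IsKBRealizable k B D}

/-- A (possibly randomized, possibly improper) learning algorithm. It maps a sample of any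
size and an internal random seed to a measurable real-valued predictor. -/
structure Learner (d : ℕ) where
  Seed : Type
  [seedSpace : MeasurableSpace Seed]
  seedLaw : Measure Seed
  [seedProb : IsProbabilityMeasure seedLaw]
  output : (m : ℕ) → (Fin m → Example d) → Seed → Feature d → ℝ
  measurable_output : ∀ m S s, Measurable (output m S s)

attribute [instance] Learner.seedSpace Learner.seedProb

/-- With `n` examples or more, whatever the distribution `D ∈ P`, the ramp loss of the output
of `A` on an i.i.d. sample from `D` is at most `ε` with probability at least `1 - δ` over the
sample and the seed. (For a non-measurable failure event its outer measure is meant.) -/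
def SampleSizeSuffices {d : ℕ} (P : Set (Measure (Example d))) (A : Learner d) (ε δ : ℝ)
    (n : ℕ) : Prop :=
  ∀ D ∈ P, ∀ m : ℕ, n ≤ m →
    ((Measure.pi fun _ : Fin m => D).prod A.seedLaw)
      {q | ε < rampRisk (A.output m q.1 q.2) D} ≤ ENNReal.ofReal δ

/-- The sample complexity of the algorithm `A` on the distributions in `P`: the least sample
size that suffices, and `⊤` if there is none. -/
def algorithmSampleComplexity {d : ℕ} (P : Set (Measure (Example d))) (A : Learner d)
    (ε δ : ℝ) : ℕ∞ :=
  ⨅ (n : ℕ) (_ : SampleSizeSuffices P A ε δ n), (n : ℕ∞)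

/-- The sample complexity of learning the distributions in `P`: the minimum of the sample
complexities of all algorithms. -/
def sampleComplexity {d : ℕ} (P : Set (Measure (Example d))) (ε δ : ℝ) : ℕ∞ :=
  ⨅ A : Learner d, algorithmSampleComplexity P A ε δ

/-- The quantity `(k log d + B²) / ε`. -/
def kbRate (d k : ℕ) (B ε : ℝ) : ℝ := ((k : ℝ) * Real.log (d : ℝ) + B ^ 2) / ε

end RulesFirst

end

open MeasureTheory

noncomputable section

namespace RulesFirst

/-! ### The margin perceptron -/

section Perceptron

variable {E ι : Type*} [NormedAddCommGroup E] [InnerProductSpace ℝ E]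

/-! The proof is a sample compression argument. Once `κ` is known, the examples on which no feature
of `κ` is positive are separated with margin 1 by a vector of norm at most `B`, so a perceptron that
updates on margin violations needs at most `T = ⌊3 * B ^ 2⌋₊` updates (`exists_selectedSum_margin`).
Hence almost every sample has a consistent predictor described by `κ` and `T` optional sample
indices. A description fixed in advance is tested by at least `m - T` fresh examples, so it is
consistent with risk above `ε` with probability at most `(1 - ε) ^ (m - T)`
(`measure_compressed_failure_le`). A union bound over at most `(d + 1) ^ k * (m + 1) ^ T`
descriptions (`measure_failure_le`, `union_bound_le`) gives the rate for `B ≥ 1`; for `B < 1` no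
data are needed. -/

/-- The sum of the vectors `z i` selected (with repetitions) by the slots of `f`. -/
def selectedSum {T : ℕ} (z : ι → E) (f : Fin T → Option ι) : E :=
  ∑ t, (f t).elim 0 z

/-- Adding a violating `z i` to `v` raises the inner product with `u` by at least 1 and `‖v‖ ^ 2` by
at most 3, since the cross term is below 2. Slots from `t` on stay empty to leave room for the next
update. -/
theorem perceptron_run (z : ι → E) (J : Set ι) (u : E) (hz : ∀ i ∈ J, ‖z i‖ ≤ 1)
    (hu : ∀ i ∈ J, 1 ≤ inner ℝ u (z i)) (T t : ℕ) (ht : t ≤ T) :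
    (∃ f : Fin T → Option ι, ∀ i ∈ J, 1 ≤ inner ℝ (selectedSum z f) (z i)) ∨
    ∃ f : Fin T → Option ι, (∀ s : Fin T, t ≤ s → f s = none) ∧
      (t : ℝ) ≤ inner ℝ u (selectedSum z f) ∧ ‖selectedSum z f‖ ^ 2 ≤ 3 * t := by
  classical
  induction t with
  | zero =>
    refine Or.inr ⟨fun _ => none, fun _ _ => rfl, ?_, ?_⟩ <;> simp [selectedSum]
  | succ t ih =>
    rcases ih (by omega) with h | ⟨f, hf, hfu, hfn⟩
    · exact Or.inl h
    by_cases hc : ∀ i ∈ J, 1 ≤ inner ℝ (selectedSum z f) (z i)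
    · exact Or.inl ⟨f, hc⟩
    push Not at hc
    obtain ⟨i, hiJ, hi⟩ := hc
    have hsum : selectedSum z (Function.update f ⟨t, ht⟩ (some i)) = selectedSum z f + z i := by
      have key : ∀ s : Fin T, (Function.update f ⟨t, ht⟩ (some i) s).elim 0 z =
          (f s).elim 0 z + if s = ⟨t, ht⟩ then z i else 0 := by
        intro s
        by_cases hs : s = ⟨t, ht⟩
        · subst hs
          simp [hf ⟨t, ht⟩ le_rfl]
        · simp [hs]
      simp [selectedSum, key, Finset.sum_add_distrib]
    refine Or.inr ⟨Function.update f ⟨t, ht⟩ (some i), fun s hs => ?_, ?_, ?_⟩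
    · rw [Function.update_of_ne (by rintro rfl; simp at hs), hf s (by omega)]
    · rw [hsum, inner_add_right]
      push_cast
      linarith [hu i hiJ]
    · rw [hsum, norm_add_sq_real]
      push_cast
      nlinarith [hz i hiJ, norm_nonneg (z i)]

/-- The perceptron that updates on every margin violation makes at most `3 B ^ 2` updates. -/
theorem exists_selectedSum_margin (z : ι → E) (J : Set ι) (u : E) (B : ℝ)
    (hz : ∀ i ∈ J, ‖z i‖ ≤ 1) (hu : ∀ i ∈ J, 1 ≤ inner ℝ u (z i)) (hB : ‖u‖ ^ 2 ≤ B ^ 2) :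
    ∃ f : Fin ⌊3 * B ^ 2⌋₊ → Option ι, ∀ i ∈ J, 1 ≤ inner ℝ (selectedSum z f) (z i) := by
  rcases perceptron_run z J u hz hu ⌊3 * B ^ 2⌋₊ _ le_rfl with h | ⟨f, -, hfu, hfn⟩
  · exact h
  have h3 : (3 * B ^ 2 : ℝ) < ⌊3 * B ^ 2⌋₊ + 1 := Nat.lt_floor_add_one _
  generalize ⌊3 * B ^ 2⌋₊ = T at *
  refine ⟨f, ?_⟩
  by_contra! hc
  obtain ⟨i, hiJ, hi⟩ := hc
  -- A violation after `T` updates allows one more, and Cauchy–Schwarz then forces `T + 1 ≤ 3 * B ^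
  -- 2`. No slot is needed for this last vector.
  set v := selectedSum z f + z i with hv
  have h1 : (T : ℝ) + 1 ≤ inner ℝ u v := by
    rw [hv, inner_add_right]
    linarith [hu i hiJ]
  have h2 : ‖v‖ ^ 2 ≤ 3 * (T + 1) := by
    rw [hv, norm_add_sq_real]
    nlinarith [hz i hiJ, norm_nonneg (z i)]
  have h4 : (T : ℝ) + 1 ≤ ‖u‖ * ‖v‖ := h1.trans (real_inner_le_norm u v)
  have hT : (0 : ℝ) < T + 1 := by positivity
  have h5 : ((T : ℝ) + 1) ^ 2 ≤ ‖u‖ ^ 2 * ‖v‖ ^ 2 := by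
    rw [← mul_pow]
    exact pow_le_pow_left₀ hT.le h4 2
  have h6 : ‖u‖ ^ 2 * ‖v‖ ^ 2 ≤ B ^ 2 * (3 * (T + 1)) :=
    mul_le_mul hB h2 (by positivity) (by positivity)
  nlinarith

end Perceptron

/-! ### Sample compression -/

/-- If the set `G S` depends only on the coordinates of `S` that satisfy `p`, then with small
probability it has large measure but is missed by all other coordinates. -/
theorem measure_pi_missed_le {X ι : Type*} [MeasurableSpace X] [Fintype ι] (D : Measure X)
    [IsProbabilityMeasure D] (p : ι → Prop) [DecidablePred p] (G : Set ((ι → X) × X))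
    (hG : MeasurableSet G)
    (hdep : ∀ S S' : ι → X, (∀ i, p i → S i = S' i) → ∀ x, (S, x) ∈ G → (S', x) ∈ G)
    (ε : ENNReal) :
    (Measure.pi fun _ : ι => D)
      {S | (∀ i, ¬ p i → (S, S i) ∉ G) ∧ ε ≤ D {x | (S, x) ∈ G}} ≤
      (1 - ε) ^ Fintype.card {i // ¬ p i} := by
  set E : Set (ι → X) := {S | (∀ i, ¬ p i → (S, S i) ∉ G) ∧ ε ≤ D {x | (S, x) ∈ G}} with hE
  have hEm : MeasurableSet E := by
    refine MeasurableSet.inter (s₁ := {S | ∀ i, ¬ p i → (S, S i) ∉ G}) ?_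
      (measurableSet_le measurable_const (measurable_measure_prodMk_left (ν := D) hG))
    simp only [Set.ofPred_forall]
    refine MeasurableSet.iInter fun i => MeasurableSet.iInter fun _ => ?_
    exact (measurable_id.prodMk (measurable_pi_apply i)) hG.compl
  have hmp := (measurePreserving_piEquivPiSubtypeProd (fun _ : ι => D) p).symm
  rw [← hmp.measure_preimage hEm.nullMeasurableSet,
    Measure.prod_apply (hmp.measurable hEm)]
  set e := (MeasurableEquiv.piEquivPiSubtypeProd (fun _ : ι => X) p).symm with he
  have hep : ∀ s z i (hi : p i), e (s, z) i = s ⟨i, hi⟩ := by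
    intro s z i hi
    simp [he, MeasurableEquiv.piEquivPiSubtypeProd, Equiv.piEquivPiSubtypeProd, hi]
  have hen : ∀ s z i (hi : ¬ p i), e (s, z) i = z ⟨i, hi⟩ := by
    intro s z i hi
    simp [he, MeasurableEquiv.piEquivPiSubtypeProd, Equiv.piEquivPiSubtypeProd, hi]
  have hsec : ∀ s, (Measure.pi fun _ : {i // ¬ p i} => D) (Prod.mk s ⁻¹' (e ⁻¹' E)) ≤
      (1 - ε) ^ Fintype.card {i // ¬ p i} := by
    intro s
    by_cases hne : ∃ z₀, e (s, z₀) ∈ E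
    · obtain ⟨z₀, hz₀⟩ := hne
      -- With the coordinates in `p` frozen at `s`, the set to be missed is the same for all `z`, so
      -- any `z₀` computes it and the other coordinates miss it independently.
      set A : Set X := {x | (e (s, z₀), x) ∈ G} with hA
      have hAm : MeasurableSet A := measurable_prodMk_left hG
      have hsub : Prod.mk s ⁻¹' (e ⁻¹' E) ⊆ Set.univ.pi fun _ : {i // ¬ p i} => Aᶜ := by
        intro z hz i _ hi
        refine hz.1 i i.2 ?_
        rw [hen s z i i.2]
        exact hdep _ _ (fun j hj => by rw [hep s _ j hj, hep s _ j hj]) _ hi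
      refine (measure_mono hsub).trans ?_
      rw [Measure.pi_pi, Finset.prod_const, Finset.card_univ, prob_compl_eq_one_sub hAm]
      gcongr
      exact hz₀.2
    · have : Prod.mk s ⁻¹' (e ⁻¹' E) = ∅ := by
        ext z
        simp only [Set.mem_preimage, Set.mem_empty_iff_false, iff_false]
        exact fun hz => hne ⟨z, hz⟩
      simp [this]
  refine (lintegral_mono hsec).trans ?_
  simp

/-! ### The predictors -/

variable {d : ℕ}

/-- Predict `1` if a feature in `κ` is positive, and `⟨w, x⟩` otherwise. -/
def rulePredictor (κ : Finset (Fin d)) (w x : Feature d) : ℝ :=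
  open scoped Classical in if ∃ j ∈ κ, 0 < x j then 1 else inner ℝ w x

theorem measurableSet_rule (κ : Finset (Fin d)) :
    MeasurableSet {x : Feature d | ∃ j ∈ κ, 0 < x j} := by
  have : {x : Feature d | ∃ j ∈ κ, 0 < x j} = ⋃ j ∈ κ, {x : Feature d | 0 < x j} := by
    ext; simp
  rw [this]
  refine Finset.measurableSet_biUnion κ fun j _ => ?_
  exact measurableSet_lt measurable_const (by fun_prop)

theorem measurable_rulePredictor (κ : Finset (Fin d)) :
    Measurable fun q : Feature d × Feature d => rulePredictor κ q.1 q.2 := by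
  classical
  exact Measurable.ite (measurable_snd (measurableSet_rule κ)) measurable_const
    (by fun_prop)

/-- The signed instance `y x` of a labelled example. -/
def signedInstance (p : Example d) : Feature d := (p.2 : ℝ) • p.1

theorem measurable_signedInstance : Measurable (signedInstance (d := d)) := by
  unfold signedInstance
  exact (measurable_subtype_coe.comp measurable_snd).smul measurable_fst

/-- The predictor has ramp loss zero on the example `p`. -/
def HasMargin (h : Feature d → ℝ) (p : Example d) : Prop := 1 ≤ (p.2 : ℝ) * h p.1

/-- The ramp loss never exceeds 1 and vanishes at margin 1; this is why the perceptron aims at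
margin 1 and not only at correct signs. -/
theorem rampRisk_le_measure (h : Feature d → ℝ) (hh : Measurable h) (D : Measure (Example d))
    [IsProbabilityMeasure D] : rampRisk h D ≤ D.real {p | ¬ HasMargin h p} := by
  have hm : MeasurableSet {p : Example d | ¬ HasMargin h p} := by
    refine (measurableSet_le (f := fun _ => (1 : ℝ)) (g := fun p : Example d => (p.2 : ℝ) * h p.1)
      measurable_const ?_).compl
    exact (measurable_subtype_coe.comp measurable_snd).mul (hh.comp measurable_fst)
  rw [← integral_indicator_one hm]
  refine integral_mono_of_nonneg (Filter.Eventually.of_forall fun p => le_max_left _ _)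
    ((integrable_const (1 : ℝ)).indicator hm) (Filter.Eventually.of_forall fun p => ?_)
  by_cases hp : HasMargin h p
  · have : 1 - h p.1 * (p.2 : ℝ) ≤ 0 := by
      unfold HasMargin at hp
      linarith [mul_comm (h p.1) (p.2 : ℝ)]
    simp [rampLoss, hp, this]
  · simp [rampLoss, hp]

/-- The predictor described by a set of features and a selection of sample points. -/
def compressedPredictor {m T : ℕ} (S : Fin m → Example d) (κ : Finset (Fin d))
    (f : Fin T → Option (Fin m)) : Feature d → ℝ :=
  rulePredictor κ (selectedSum (fun i => signedInstance (S i)) f)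

theorem measurable_compressedPredictor {m T : ℕ} (κ : Finset (Fin d))
    (f : Fin T → Option (Fin m)) :
    Measurable fun q : (Fin m → Example d) × Feature d => compressedPredictor q.1 κ f q.2 := by
  have hsel : Measurable fun q : (Fin m → Example d) × Feature d =>
      selectedSum (fun i => signedInstance (q.1 i)) f := by
    unfold selectedSum
    refine Finset.measurable_sum _ fun t _ => ?_
    cases f t with
    | none => exact measurable_const
    | some i =>
      exact measurable_signedInstance.comp ((measurable_pi_apply i).comp measurable_fst)
  exact (measurable_rulePredictor κ).comp (hsel.prodMk measurable_snd)

theorem measurableSet_not_hasMargin {m T : ℕ} (κ : Finset (Fin d))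
    (f : Fin T → Option (Fin m)) :
    MeasurableSet {q : (Fin m → Example d) × Example d |
      ¬ HasMargin (compressedPredictor q.1 κ f) q.2} := by
  have hy : Measurable fun q : (Fin m → Example d) × Example d => (q.2.2 : ℝ) :=
    measurable_subtype_coe.comp (measurable_snd.comp measurable_snd)
  have hx : Measurable fun q : (Fin m → Example d) × Example d => (q.1, q.2.1) :=
    measurable_fst.prodMk (measurable_fst.comp measurable_snd)
  exact (measurableSet_le measurable_const
    (hy.mul ((measurable_compressedPredictor κ f).comp hx))).compl

theorem measure_compressed_failure_le {m T : ℕ} (κ : Finset (Fin d))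
    (f : Fin T → Option (Fin m)) (D : Measure (Example d)) [IsProbabilityMeasure D] (ε : ℝ) :
    (Measure.pi fun _ : Fin m => D)
      {S | (∀ i, HasMargin (compressedPredictor S κ f) (S i)) ∧
        ε < rampRisk (compressedPredictor S κ f) D} ≤ (1 - ENNReal.ofReal ε) ^ (m - T) := by
  classical
  let p : Fin m → Prop := fun i => ∃ t, f t = some i
  let G : Set ((Fin m → Example d) × Example d) :=
    {q | ¬ HasMargin (compressedPredictor q.1 κ f) q.2}
  have hG : MeasurableSet G := measurableSet_not_hasMargin κ f
  have hdep : ∀ S S' : Fin m → Example d, (∀ i, p i → S i = S' i) →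
      ∀ x, (S, x) ∈ G → (S', x) ∈ G := by
    intro S S' hS x hx
    have : compressedPredictor S κ f = compressedPredictor S' κ f := by
      unfold compressedPredictor
      congr 1
      refine Finset.sum_congr rfl fun t _ => ?_
      cases ht : f t with
      | none => rfl
      | some i => simp [hS i ⟨t, ht⟩]
    change ¬ HasMargin (compressedPredictor S' κ f) x
    rw [← this]
    exact hx
  -- Slots may be empty or repeat an index, so at most `T` sample points are used.
  have hcard : m - T ≤ Fintype.card {i // ¬ p i} := by
    rw [Fintype.card_subtype_compl, Fintype.card_fin]
    refine Nat.sub_le_sub_left ?_ m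
    choose t ht using fun i : {i // p i} => i.2
    simpa using Fintype.card_le_of_injective t fun i j hij => Subtype.ext <| by
      have h := ht i
      rw [hij, ht j] at h
      exact (Option.some.inj h).symm
  refine (measure_mono ?_).trans ((measure_pi_missed_le D p G hG hdep (ENNReal.ofReal ε)).trans
    (pow_le_pow_right_of_le_one' tsub_le_self hcard))
  rintro S ⟨hS, hr⟩
  refine ⟨fun i _ hi => hi (hS i), ?_⟩
  have hmeas : Measurable (compressedPredictor S κ f) :=
    (measurable_compressedPredictor κ f).comp measurable_prodMk_left
  have h := hr.le.trans (rampRisk_le_measure _ hmeas D)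
  exact ENNReal.ofReal_le_of_le_toReal h

/-! ### The learner -/

/-- A set of at most `k` features and a selection of `T` sample points whose predictor has
ramp loss zero on the sample. -/
def IsConsistent {m T : ℕ} (k : ℕ) (S : Fin m → Example d)
    (c : Finset (Fin d) × (Fin T → Option (Fin m))) : Prop :=
  c.1.card ≤ k ∧ ∀ i, HasMargin (compressedPredictor S c.1 c.2) (S i)

/-- The deterministic algorithm that outputs a consistent compressed predictor. -/
def compressionLearner (d k T : ℕ) : Learner d where
  Seed := Unit
  seedLaw := Measure.dirac ()
  output m S _ :=
    open scoped Classical in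
    if h : ∃ c : Finset (Fin d) × (Fin T → Option (Fin m)), IsConsistent k S c then
      compressedPredictor S h.choose.1 h.choose.2 else 0
  measurable_output m S s := by
    split_ifs with h
    · exact (measurable_compressedPredictor _ _).comp measurable_prodMk_left
    · exact measurable_const

/-- The constant predictor `1`. -/
def constantLearner (d : ℕ) : Learner d where
  Seed := Unit
  seedLaw := Measure.dirac ()
  output _ _ _ _ := 1
  measurable_output _ _ _ := measurable_const

theorem norm_signedInstance (p : Example d) : ‖signedInstance p‖ = ‖p.1‖ := by
  rcases p with ⟨x, y, rfl | rfl⟩ <;> simp [signedInstance]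

/-- The perceptron runs only on the sample points where no feature of `κ` is positive; on the others
the rule already predicts the correct label 1. -/
theorem exists_isConsistent {m k : ℕ} {B : ℝ} (S : Fin m → Example d) (κ : Finset (Fin d))
    (w : Feature d) (hκ : κ.card ≤ k) (hw : ‖w‖ ^ 2 ≤ B ^ 2) (hS : ∀ i, ‖(S i).1‖ ≤ 1)
    (h1 : ∀ i, (∃ j ∈ κ, 0 < (S i).1 j) → ((S i).2 : ℝ) = 1)
    (h2 : ∀ i, (∀ j ∈ κ, (S i).1 j ≤ 0) → 1 ≤ ((S i).2 : ℝ) * inner ℝ w (S i).1) :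
    ∃ c : Finset (Fin d) × (Fin ⌊3 * B ^ 2⌋₊ → Option (Fin m)), IsConsistent k S c := by
  obtain ⟨f, hf⟩ := exists_selectedSum_margin (fun i => signedInstance (S i))
    {i | ∀ j ∈ κ, (S i).1 j ≤ 0} w B (fun i _ => by rw [norm_signedInstance]; exact hS i)
    (fun i hi => by simpa [signedInstance, inner_smul_right] using h2 i hi) hw
  refine ⟨(κ, f), hκ, fun i => ?_⟩
  unfold HasMargin compressedPredictor rulePredictor
  split_ifs with hi
  · rw [h1 i hi, one_mul]
  · push Not at hi
    simpa [signedInstance, inner_smul_right] using hf i hi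

theorem ae_forall_pi {m : ℕ} {X : Type*} [MeasurableSpace X] (D : Measure X)
    [IsProbabilityMeasure D] {P : X → Prop} (h : ∀ᵐ x ∂D, P x) :
    ∀ᵐ S ∂(Measure.pi fun _ : Fin m => D), ∀ i, P (S i) :=
  ae_all_iff.2 fun i =>
    (measurePreserving_eval (fun _ : Fin m => D) i).quasiMeasurePreserving.ae h

theorem measure_failure_le (d k m : ℕ) (B ε : ℝ) (D : Measure (Example d))
    (hD : D ∈ kbDistributions d k B) :
    ((Measure.pi fun _ : Fin m => D).prod (compressionLearner d k ⌊3 * B ^ 2⌋₊).seedLaw)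
      {q | ε < rampRisk ((compressionLearner d k ⌊3 * B ^ 2⌋₊).output m q.1 q.2) D} ≤
    (((Finset.univ.filter fun κ : Finset (Fin d) => κ.card ≤ k).card *
      (m + 1) ^ ⌊3 * B ^ 2⌋₊ : ℕ) : ENNReal) *
        (1 - ENNReal.ofReal ε) ^ (m - ⌊3 * B ^ 2⌋₊) := by
  classical
  obtain ⟨hprob, hball, κ₀, w, hκ₀, hw, h1, h2⟩ := hD
  set T := ⌊3 * B ^ 2⌋₊ with hT
  set μ := Measure.pi fun _ : Fin m => D with hμ
  set K := Finset.univ.filter fun κ : Finset (Fin d) => κ.card ≤ k with hK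
  let E : Finset (Fin d) × (Fin T → Option (Fin m)) → Set (Fin m → Example d) := fun c =>
    {S | (∀ i, HasMargin (compressedPredictor S c.1 c.2) (S i)) ∧
        ε < rampRisk (compressedPredictor S c.1 c.2) D}
  let Z : Set (Fin m → Example d) :=
    {S | ¬ ∃ c : Finset (Fin d) × (Fin T → Option (Fin m)), IsConsistent k S c}
  have hZ : μ Z = 0 := by
    change ∀ᵐ S ∂μ, _
    filter_upwards [ae_forall_pi D hball, ae_forall_pi D h1, ae_forall_pi D h2]
      with S hS0 hS1 hS2
    exact exists_isConsistent S κ₀ w hκ₀ hw hS0 hS1 hS2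
  -- The chosen description depends on the sample, with no measurability known, so the failure event
  -- is covered by the events of all fixed descriptions.
  have hsub : {q : (Fin m → Example d) × (compressionLearner d k T).Seed |
        ε < rampRisk ((compressionLearner d k T).output m q.1 q.2) D} ⊆
      (Z ∪ ⋃ c ∈ K ×ˢ Finset.univ, E c) ×ˢ Set.univ := by
    rintro ⟨S, s⟩ hq
    refine ⟨?_, trivial⟩
    by_cases hS : ∃ c : Finset (Fin d) × (Fin T → Option (Fin m)), IsConsistent k S c
    · right
      change ε < rampRisk (if h : ∃ c : Finset (Fin d) × (Fin T → Option (Fin m)),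
        IsConsistent k S c then compressedPredictor S h.choose.1 h.choose.2 else 0) D at hq
      rw [dif_pos hS] at hq
      refine Set.mem_biUnion (x := hS.choose) ?_ ⟨hS.choose_spec.2, hq⟩
      simpa [hK] using hS.choose_spec.1
    · exact Or.inl hS
  refine (measure_mono hsub).trans ?_
  rw [Measure.prod_prod, measure_univ, mul_one]
  refine (measure_union_le _ _).trans ?_
  rw [hZ, zero_add]
  refine (measure_biUnion_finset_le _ _).trans ?_
  refine (Finset.sum_le_sum fun c _ => measure_compressed_failure_le c.1 c.2 D ε).trans ?_
  rw [Finset.sum_const, Finset.card_product]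
  simp

/-! ### Counting -/

theorem card_filter_card_le (d k : ℕ) :
    (Finset.univ.filter fun κ : Finset (Fin d) => κ.card ≤ k).card ≤ (d + 1) ^ k := by
  classical
  have h : (Finset.univ.filter fun κ : Finset (Fin d) => κ.card ≤ k).card ≤
      (Finset.univ : Finset (Fin k → Option (Fin d))).card := by
    refine Finset.card_le_card_of_surjOn
      (fun g => Finset.univ.filter fun j => ∃ i, g i = some j) ?_
    intro κ hκ
    have hκ' : κ.card ≤ k := by simpa using hκ
    refine ⟨fun i => κ.toList[(i : ℕ)]?, by simp, ?_⟩
    ext j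
    simp only [Finset.mem_filter, Finset.mem_univ, true_and]
    rw [← Finset.mem_toList, List.mem_iff_getElem?]
    constructor
    · rintro ⟨i, hi⟩
      exact ⟨i, hi⟩
    · rintro ⟨i, hi⟩
      have hlt : i < κ.toList.length := (List.getElem?_eq_some_iff.1 hi).1
      rw [Finset.length_toList] at hlt
      exact ⟨⟨i, by omega⟩, hi⟩
  simpa using h

/-- For `d ≥ 2`, `d + 1 ≤ d ^ 2` gives the factor 2. For `d ≤ 1` the logarithm of `d` is 0 but there
may be two sets, whence the `+ 1`. -/
theorem log_card_filter_card_le (d k : ℕ) :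
    Real.log (Finset.univ.filter fun κ : Finset (Fin d) => κ.card ≤ k).card ≤
      2 * (k * Real.log d) + 1 := by
  set N := (Finset.univ.filter fun κ : Finset (Fin d) => κ.card ≤ k).card with hN
  have hpos : (0 : ℝ) < N := by
    exact_mod_cast Finset.card_pos.2 ⟨∅, by simp⟩
  have hnn : 0 ≤ k * Real.log (d : ℝ) := by positivity
  by_cases hd : d ≤ 1
  · have h2 : N ≤ 2 := by
      refine (Finset.card_filter_le _ _).trans ?_
      simp only [Finset.card_univ, Fintype.card_finset, Fintype.card_fin]
      exact Nat.pow_le_pow_right two_pos hd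
    have h3 : Real.log N ≤ Real.log 2 := Real.log_le_log hpos (by exact_mod_cast h2)
    linarith [Real.log_two_lt_d9]
  · have h1 : N ≤ (d ^ 2) ^ k :=
      (card_filter_card_le d k).trans (Nat.pow_le_pow_left (by nlinarith) k)
    have h3 : Real.log N ≤ Real.log (((d : ℝ) ^ 2) ^ k) :=
      Real.log_le_log hpos (by exact_mod_cast h1)
    rw [Real.log_pow, Real.log_pow] at h3
    push_cast at h3
    nlinarith

/-- The union bound is effective from the sample size of the theorem on. -/
theorem union_bound_le (d k m : ℕ) (B ε δ : ℝ) (hB : 1 ≤ B) (hε : 0 < ε) (hε1 : ε < 1)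
    (hδ : 0 < δ) (hδ1 : δ < 1)
    (hm : (32 + 2 * Real.log δ⁻¹) * kbRate d k B ε * Real.log (kbRate d k B ε + 2) ≤ m) :
    (((Finset.univ.filter fun κ : Finset (Fin d) => κ.card ≤ k).card *
      (m + 1) ^ ⌊3 * B ^ 2⌋₊ : ℕ) : ENNReal) *
        (1 - ENNReal.ofReal ε) ^ (m - ⌊3 * B ^ 2⌋₊) ≤ ENNReal.ofReal δ := by
  set N := (Finset.univ.filter fun κ : Finset (Fin d) => κ.card ≤ k).card with hN
  set T := ⌊3 * B ^ 2⌋₊ with hT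
  set F := kbRate d k B ε with hF
  set L := Real.log δ⁻¹ with hL
  set l := Real.log (F + 2) with hl
  have hNpos : (0 : ℝ) < N := by
    exact_mod_cast Finset.card_pos.2 ⟨∅, by simp⟩
  have hlogd : 0 ≤ k * Real.log (d : ℝ) := by positivity
  have hB2 : 1 ≤ B ^ 2 := by nlinarith
  have hεF : ε * F = k * Real.log d + B ^ 2 := by
    rw [hF, kbRate]
    field_simp
  have hF1 : 1 ≤ F := by nlinarith
  have hT3 : (T : ℝ) ≤ 3 * B ^ 2 := Nat.floor_le (by positivity)
  have hL0 : 0 ≤ L := Real.log_nonneg ((one_le_inv₀ hδ).2 hδ1.le)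
  have hl1 : 1 ≤ l := by
    rw [hl, Real.le_log_iff_exp_le (by linarith)]
    linarith [Real.exp_one_lt_d9]
  have hlogF : Real.log (6 * F) ≤ 2 + l := by
    rw [Real.log_mul (by norm_num) (by linarith)]
    have h6 : Real.log 6 ≤ 2 := by
      rw [Real.log_le_iff_le_exp (by norm_num)]
      have h := Real.exp_one_gt_d9
      have h2 : Real.exp 2 = Real.exp 1 * Real.exp 1 := by
        rw [← Real.exp_add]; norm_num
      nlinarith
    have : Real.log F ≤ l := Real.log_le_log (by linarith) (by linarith)
    linarith
  have hm0 : (0 : ℝ) < m + 1 := by positivity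
  -- The tangent to `log` at `6 * F` is used, so that the logarithmic term costs only half of `m`.
  have hlogm : 3 * F * Real.log (m + 1) ≤ (m + 1) / 2 + 3 * F * (2 + l) := by
    have h6F : 0 < 6 * F := by linarith
    have h := Real.log_le_sub_one_of_pos (div_pos hm0 h6F)
    rw [Real.log_div hm0.ne' h6F.ne'] at h
    have h2 : Real.log (m + 1) ≤ (m + 1) / (6 * F) + (2 + l) := by linarith
    calc 3 * F * Real.log (m + 1) ≤ 3 * F * ((m + 1) / (6 * F) + (2 + l)) := by gcongr
      _ = (m + 1) / 2 + 3 * F * (2 + l) := by field_simp; ring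
  have hlm0 : 0 ≤ Real.log ((m : ℝ) + 1) := Real.log_nonneg (by linarith [m.cast_nonneg (α := ℝ)])
  have hFl : F ≤ F * l := le_mul_of_one_le_right (by linarith) hl1
  have hLF : L * F ≤ L * (F * l) := mul_le_mul_of_nonneg_left hFl hL0
  -- After multiplication by `ε`, the 6 pays for `log N` (3) and `ε * T` (3), and `L` for the
  -- confidence. Solving for `m` doubles the terms not in `m`, which 32 covers.
  have hmain : (6 + L) * F + 3 * F * Real.log (m + 1) ≤ m := by
    have : (32 + 2 * L) * F * l = 32 * (F * l) + 2 * (L * (F * l)) := by ring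
    nlinarith
  have hTF : (T : ℝ) ≤ 3 * F := by nlinarith
  have hTm : T ≤ m := by
    have : 0 ≤ 3 * F * Real.log ((m : ℝ) + 1) := by positivity
    have : (T : ℝ) ≤ m := by nlinarith
    exact_mod_cast this
  have hexp : Real.log N + T * Real.log (m + 1) + L ≤ ε * (m - T) := by
    have h1 := log_card_filter_card_le d k
    rw [← hN] at h1
    have h2 : ε * ((6 + L) * F + 3 * F * Real.log (m + 1)) ≤ ε * m := by gcongr
    have h3 : ε * ((6 + L) * F + 3 * F * Real.log (m + 1)) =
        (6 + L + 3 * Real.log (m + 1)) * (ε * F) := by ring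
    have hεF1 : B ^ 2 ≤ ε * F := by linarith
    have h4 : T * Real.log ((m : ℝ) + 1) ≤ 3 * (ε * F) * Real.log (m + 1) := by
      gcongr
      linarith
    have h5 : L ≤ L * (ε * F) := le_mul_of_one_le_right hL0 (by linarith)
    have h6 : ε * T ≤ T := mul_le_of_le_one_left (by positivity) hε1.le
    nlinarith
  have hreal : (N * (m + 1) ^ T : ℝ) * (1 - ε) ^ (m - T) ≤ δ := by
    have h1 : (1 - ε) ^ (m - T) ≤ Real.exp (-(ε * (m - T))) := by
      calc (1 - ε) ^ (m - T) ≤ (Real.exp (-ε)) ^ (m - T) :=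
            pow_le_pow_left₀ (by linarith) (Real.one_sub_le_exp_neg ε) _
        _ = Real.exp (-(ε * (m - T))) := by
            rw [← Real.exp_nat_mul, Nat.cast_sub hTm]
            ring_nf
    have h2 : (N * (m + 1) ^ T : ℝ) = Real.exp (Real.log N + T * Real.log (m + 1)) := by
      rw [Real.exp_add, Real.exp_log hNpos, Real.exp_nat_mul, Real.exp_log hm0]
    calc (N * (m + 1) ^ T : ℝ) * (1 - ε) ^ (m - T)
        ≤ Real.exp (Real.log N + T * Real.log (m + 1)) * Real.exp (-(ε * (m - T))) := by
          rw [h2]; gcongr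
      _ ≤ Real.exp (-L) := by
          rw [← Real.exp_add]
          exact Real.exp_le_exp.2 (by linarith)
      _ = δ := by rw [hL, Real.log_inv, neg_neg, Real.exp_log hδ]
  calc ((N * (m + 1) ^ T : ℕ) : ENNReal) * (1 - ENNReal.ofReal ε) ^ (m - T)
      = ENNReal.ofReal ((N * (m + 1) ^ T : ℝ) * (1 - ε) ^ (m - T)) := by
        rw [ENNReal.ofReal_mul (by positivity), ENNReal.ofReal_pow (by linarith),
          ENNReal.ofReal_sub _ hε.le, ENNReal.ofReal_one, ← ENNReal.ofReal_natCast]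
        push_cast
        rfl
    _ ≤ ENNReal.ofReal δ := ENNReal.ofReal_le_ofReal hreal

/-! ### The sample complexity -/

theorem sampleComplexity_le {P : Set (Measure (Example d))} {A : Learner d} {ε δ : ℝ} {n : ℕ}
    (h : SampleSizeSuffices P A ε δ n) : sampleComplexity P ε δ ≤ n :=
  (iInf_le _ A).trans (iInf₂_le n h)

/-- If `B < 1` then almost surely a feature in `κ` is positive, and the label is `1`. -/
theorem sampleComplexity_of_lt_one (d k : ℕ) (B ε δ : ℝ) (hB0 : 0 ≤ B) (hB : B < 1)
    (hε : 0 < ε) : sampleComplexity (kbDistributions d k B) ε δ ≤ (0 : ℕ) := by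
  refine sampleComplexity_le (A := constantLearner d) fun D hD m _ => ?_
  obtain ⟨hprob, hball, κ, w, -, hw, h1, h2⟩ := hD
  have hrisk : rampRisk (fun _ => 1) D = 0 := by
    refine integral_eq_zero_of_ae ?_
    filter_upwards [hball, h1, h2] with p hp hp1 hp2
    by_cases hj : ∃ j ∈ κ, 0 < p.1 j
    · simp [rampLoss, hp1 hj]
    · push Not at hj
      exfalso
      have hin : ∀ c : ℝ, |c| ≤ 1 → c * inner ℝ w p.1 < 1 := by
        intro c hc
        have hwB : ‖w‖ ≤ B := le_of_sq_le_sq hw hB0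
        calc c * inner ℝ w p.1 ≤ |c * inner ℝ w p.1| := le_abs_self _
          _ = |c| * |inner ℝ w p.1| := abs_mul _ _
          _ ≤ 1 * (‖w‖ * ‖p.1‖) := by
            gcongr
            exact abs_real_inner_le_norm w p.1
          _ ≤ 1 * (B * 1) := by gcongr
          _ < 1 := by linarith
      have hy : |(p.2 : ℝ)| ≤ 1 := by
        rcases p.2.2 with h | h <;> simp_all
      exact absurd (hp2 hj) (not_le.2 (hin _ hy))
  have : {q : (Fin m → Example d) × (constantLearner d).Seed |
      ε < rampRisk ((constantLearner d).output m q.1 q.2) D} = ∅ := by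
    exact Set.eq_empty_of_forall_notMem fun q hq =>
      (hrisk.trans_le hε.le).not_gt (show ε < rampRisk (fun _ => 1) D from hq)
  simp [this]

end RulesFirst

end

theorem mainTheorem3 :
    ∃ c : ℕ, ∀ δ : ℝ, 0 < δ → δ < 1 → ∃ C : ℝ, 0 < C ∧
      ∀ (d k : ℕ) (B ε : ℝ), 0 ≤ B → 0 < ε → ε < 1 →
        ∃ n : ℕ,
          RulesFirst.sampleComplexity (RulesFirst.kbDistributions d k B) ε δ = (n : ℕ∞) ∧
          (n : ℝ) ≤ C * RulesFirst.kbRate d k B ε *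
            Real.log (RulesFirst.kbRate d k B ε + 2) ^ c := by
  refine ⟨1, fun δ hδ hδ1 => ?_⟩
  have hL0 : 0 ≤ Real.log δ⁻¹ := Real.log_nonneg ((one_le_inv₀ hδ).2 hδ1.le)
  -- One more than the 32 of `union_bound_le`, to absorb the rounding up.
  refine ⟨33 + 2 * Real.log δ⁻¹, by linarith, fun d k B ε hB hε hε1 => ?_⟩
  set F := RulesFirst.kbRate d k B ε with hF
  suffices h : ∃ n₀ : ℕ, RulesFirst.sampleComplexity (RulesFirst.kbDistributions d k B) ε δ ≤ n₀ ∧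
      (n₀ : ℝ) ≤ (33 + 2 * Real.log δ⁻¹) * F * Real.log (F + 2) ^ 1 by
    obtain ⟨n₀, h1, h2⟩ := h
    obtain ⟨n, hn⟩ := ENat.ne_top_iff_exists.1 (h1.trans_lt (ENat.natCast_lt_top n₀)).ne
    rw [← hn] at h1
    exact ⟨n, hn.symm, le_trans (by exact_mod_cast h1) h2⟩
  rw [pow_one]
  -- For `B < 1` the rate `F` may be 0, which leaves no room for rounding; `B ≥ 1` ensures `F ≥ 1`.
  rcases lt_or_ge B 1 with hB1 | hB1
  · have hF0 : 0 ≤ F := by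
      rw [hF, RulesFirst.kbRate]
      positivity
    refine ⟨0, RulesFirst.sampleComplexity_of_lt_one d k B ε δ hB hB1 hε, ?_⟩
    have : 0 ≤ Real.log (F + 2) := Real.log_nonneg (by linarith)
    push_cast
    positivity
  · have hεF : ε * F = k * Real.log d + B ^ 2 := by
      rw [hF, RulesFirst.kbRate]
      field_simp
    have hlogd : 0 ≤ k * Real.log (d : ℝ) := by positivity
    have hF1 : 1 ≤ F := by nlinarith
    have hl1 : 1 ≤ Real.log (F + 2) := by
      rw [Real.le_log_iff_exp_le (by linarith)]
      linarith [Real.exp_one_lt_d9]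
    refine ⟨⌈(32 + 2 * Real.log δ⁻¹) * F * Real.log (F + 2)⌉₊,
      RulesFirst.sampleComplexity_le fun D hD m hm =>
        (RulesFirst.measure_failure_le d k m B ε D hD).trans
          (RulesFirst.union_bound_le d k m B ε δ hB1 hε hε1 hδ hδ1 (Nat.ceil_le.1 hm)), ?_⟩
    have h := (Nat.ceil_lt_add_one
      (show 0 ≤ (32 + 2 * Real.log δ⁻¹) * F * Real.log (F + 2) by positivity)).le
    have hFl : 1 ≤ F * Real.log (F + 2) := one_le_mul_of_one_le_of_one_le hF1 hl1
    linarith
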